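/- Let $n\ge 0$ and $w\in S_n$; products of permutations are compositions of functions. A (reduced) pipe dream is a tiling of the unit cells of the first quadrant by crosses and elbows, with finitely many crosses, such that any two of the resulting pipes cross at most once; following the pipes from the $y$-axis to the $x$-axis, a pipe goes straight through a cross, while an elbow joins the left side of its cell to the bottom side and the top side to the right side. The permutation $v$ of the pipe dream sends $i$ to the column in which the pipe starting in the $i$-th row from the bottom meets the $x$-axis. Let $\mathrm{YPD}(w)$ be the set of pipe dreams whose permutation $v$ is $\mathrm{rev}(w)$, where $\mathrm{rev}(w)(i)=w(n+1-i)$ for $1\le i\le n$, extended by $\mathrm{rev}(w)(i)=i$ for $i>n$. For $P\in\mathrm{YPD}(w)$ let $\mathrm{ywt}(P)_i$ be the number of crosses in the $(n+1-i)$-th row from the bottom, i.e. in the $i$-th of the $n$ bottom rows counted from the top. The Young Schubert polynomial is $$\hat{\mathfrak S}_w=\sum_{P\in\mathrm{YPD}(w)}x_1^{\mathrm{ywt}(P)_1}\cdots x_n^{\mathrm{ywt}(P)_n}\in\mathbb Z[x_1,\dots,x_n].$$ For $1\le i<n$ let $\partial_i(f)=\dfrac{f-s_i(f)}{x_i-x_{i+1}}$,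 where $s_i$ exchanges $x_i$ and $x_{i+1}$, and for $u\in S_n$ let $\partial_u=\partial_{i_1}\cdots\partial_{i_r}$ for any reduced word $u=s_{i_1}\cdots s_{i_r}$. Let $\ell(w)$ be the number of inversions of $w$. **Theorem.** The set $\mathrm{YPD}(w)$ is finite, and $$\hat{\mathfrak S}_w=(-1)^{\ell(w)}\,\partial_{w^{-1}}\bigl(x_2x_3^2\cdots x_n^{n-1}\bigr),$$ whichever reduced word of $w^{-1}$ is used to form $\partial_{w^{-1}}$. -/

import Mathlib

/-! Young Schubert polynomials and divided differences.  Indices are `0`-based: the variable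
`x_{i+1}` is `X i` for `i : Fin n`, and `S_n` is `Equiv.Perm (Fin n)` with composition as
product. -/

namespace YoungSchubert

/-! ### Pipe dreams

Unit cells of the first quadrant are pairs `(r, c) : ℕ × ℕ`, with `r` the row counted from the
bottom and `c` the column counted from the left.  A tiling by crosses and elbows, with finitely many
crosses, is given by the finite set `D` of cells carrying a cross; every other cell carries an
elbow. -/

/-- The side through which a pipe, followed from the `y`-axis to the `x`-axis, enters a cell. -/
inductive Side where
  | left : Side
  | top : Side

/-- `Enters D p r c s`: the pipe starting on the `y`-axis in row `p` enters the cell `(r, c)`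
through the side `s`.  A pipe goes straight through a cross; an elbow joins the left side of its
cell with the bottom side, and the top side with the right side. -/
inductive Enters (D : Finset (ℕ × ℕ)) (p : ℕ) : ℕ → ℕ → Side → Prop
  | start : Enters D p p 0 Side.left
  | cross_right (r c : ℕ) : (r, c) ∈ D → Enters D p r c Side.left →
      Enters D p r (c + 1) Side.left
  | cross_down (r c : ℕ) : (r + 1, c) ∈ D → Enters D p (r + 1) c Side.top →
      Enters D p r c Side.top
  | elbow_right (r c : ℕ) : (r, c) ∉ D → Enters D p r c Side.top →
      Enters D p r (c + 1) Side.left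
  | elbow_down (r c : ℕ) : (r + 1, c) ∉ D → Enters D p (r + 1) c Side.left →
      Enters D p r c Side.top

/-- The pipe starting in row `p` of the `y`-axis ends in column `c` of the `x`-axis. -/
def Exits (D : Finset (ℕ × ℕ)) (p c : ℕ) : Prop :=
  ((0, c) ∈ D ∧ Enters D p 0 c Side.top) ∨ ((0, c) ∉ D ∧ Enters D p 0 c Side.left)

/-- The pipes starting in rows `p` and `q` cross each other in the cell `x`. -/
def CrossAt (D : Finset (ℕ × ℕ)) (p q : ℕ) (x : ℕ × ℕ) : Prop :=
  x ∈ D ∧ ((Enters D p x.1 x.2 Side.left ∧ Enters D q x.1 x.2 Side.top) ∨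
    (Enters D p x.1 x.2 Side.top ∧ Enters D q x.1 x.2 Side.left))

/-- Any two pipes cross at most once. -/
def IsReduced (D : Finset (ℕ × ℕ)) : Prop :=
  ∀ p q : ℕ, p ≠ q → ∀ x y : ℕ × ℕ, CrossAt D p q x → CrossAt D p q y → x = y

/-- `PD(v)`: the reduced pipe dreams whose associated permutation is `v ∈ S_n`, regarded as a
permutation of all row and column labels that fixes everything beyond the first `n` of them. -/
def pipeDreams {n : ℕ} (v : Equiv.Perm (Fin n)) : Set (Finset (ℕ × ℕ)) :=
  {D | IsReduced D ∧ (∀ i : Fin n, Exits D (i : ℕ) (v i : ℕ)) ∧ ∀ p : ℕ, n ≤ p → Exits D p p}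

/-- `rev(w)`: the one-line notation of `w` read from right to left. -/
def rev {n : ℕ} (w : Equiv.Perm (Fin n)) : Equiv.Perm (Fin n) :=
  w * Fin.revPerm

/-- `YPD(w)`: the Young pipe dreams for `w`, that is, the diagrams from which following the pipes
from the `y`-axis (from the bottom row upwards) to the `x`-axis reads `rev(w)`. -/
def youngPipeDreams {n : ℕ} (w : Equiv.Perm (Fin n)) : Set (Finset (ℕ × ℕ)) :=
  pipeDreams (rev w)

/-- `ywt(D)`: the number of crosses in each of the rows `1, …, n` counted from the top, where the
`n`-th row from the top is the bottom row. -/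
def youngWeight (n : ℕ) (D : Finset (ℕ × ℕ)) (i : Fin n) : ℕ :=
  (D.filter fun x => x.1 = (Fin.rev i : ℕ)).card

/-- The Young Schubert polynomial of `w`, the generating function of `YPD(w)` by Young weight. -/
noncomputable def youngSchubert {n : ℕ} (w : Equiv.Perm (Fin n)) : MvPolynomial (Fin n) ℤ :=
  ∑ᶠ D ∈ youngPipeDreams w, ∏ i : Fin n, MvPolynomial.X i ^ youngWeight n D i

/-! ### Reduced words and length -/

/-- The two positions exchanged by the `i`-th simple transposition. -/
def lo {n : ℕ} (i : Fin (n - 1)) : Fin n := ⟨i, by omega⟩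

/-- See `lo`. -/
def hi {n : ℕ} (i : Fin (n - 1)) : Fin n := ⟨i + 1, by omega⟩

theorem lo_ne_hi {n : ℕ} (i : Fin (n - 1)) : lo i ≠ hi i := by
  intro h
  have := congrArg Fin.val h
  simp [lo, hi] at this

/-- The simple transposition `s_i` of `S_n`. -/
def simpleTransposition {n : ℕ} (i : Fin (n - 1)) : Equiv.Perm (Fin n) :=
  Equiv.swap (lo i) (hi i)

/-- The word `i_1 ⋯ i_r` satisfies `s_{i_1} ⋯ s_{i_r} = u`. -/
def IsWordFor {n : ℕ} (u : Equiv.Perm (Fin n)) (a : List (Fin (n - 1))) : Prop :=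
  (a.map simpleTransposition).prod = u

/-- A reduced word for `u` is a word for `u` of the least possible length. -/
def IsReducedWord {n : ℕ} (u : Equiv.Perm (Fin n)) (a : List (Fin (n - 1))) : Prop :=
  IsWordFor u a ∧ ∀ b : List (Fin (n - 1)), IsWordFor u b → a.length ≤ b.length

theorem exists_isWordFor {n : ℕ} (u : Equiv.Perm (Fin n)) : ∃ a, IsWordFor u a := by
  cases n with
  | zero => exact ⟨[], Subsingleton.elim _ _⟩
  | succ m =>
    have h : u ∈ Submonoid.closure
        (Set.range fun i : Fin m => Equiv.swap i.castSucc i.succ) := by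
      rw [Equiv.Perm.mclosure_swap_castSucc_succ]; trivial
    obtain ⟨l, hl, rfl⟩ := Submonoid.exists_list_of_mem_closure h
    clear h
    induction l with
    | nil => exact ⟨[], rfl⟩
    | cons x t ih =>
      obtain ⟨a, ha⟩ := ih fun y hy => hl y (List.mem_cons_of_mem _ hy)
      obtain ⟨i, hi⟩ := hl x List.mem_cons_self
      refine ⟨(i : Fin (m + 1 - 1)) :: a, ?_⟩
      unfold IsWordFor at ha ⊢
      rw [List.map_cons, List.prod_cons, List.prod_cons, ha, ← hi]
      rfl

theorem exists_isReducedWord {n : ℕ} (u : Equiv.Perm (Fin n)) : ∃ a, IsReducedWord u a := by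
  classical
  have h : ∃ k, ∃ a, IsWordFor u a ∧ a.length = k :=
    let ⟨a, ha⟩ := exists_isWordFor u; ⟨_, a, ha, rfl⟩
  obtain ⟨a, ha, hk⟩ := Nat.find_spec h
  exact ⟨a, ha, fun b hb => hk ▸ Nat.find_min' h ⟨b, hb, rfl⟩⟩

/-- The length `ℓ(w)`: the number of inversions of `w`. -/
def length {n : ℕ} (w : Equiv.Perm (Fin n)) : ℕ :=
  (Finset.univ.filter fun p : Fin n × Fin n => p.1 < p.2 ∧ w p.2 < w p.1).card

/-! ### Divided differences -/

/-- The quotient `(f - s_i f) / (x_i - x_{i+1})` exists in the polynomial ring. -/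
theorem exists_quotient {n : ℕ} (i : Fin (n - 1)) (f : MvPolynomial (Fin n) ℤ) :
    ∃ g : MvPolynomial (Fin n) ℤ,
      f - MvPolynomial.rename (simpleTransposition i) f
        = (MvPolynomial.X (lo i) - MvPolynomial.X (hi i)) * g := by
  change (MvPolynomial.X (lo i) - MvPolynomial.X (hi i) : MvPolynomial (Fin n) ℤ) ∣ _
  induction f using MvPolynomial.induction_on with
  | C a => simp
  | add p q hp hq =>
    have := dvd_add hp hq
    rwa [← add_sub_add_comm, ← map_add] at this
  | mul_X p k hp =>
    have hX : (MvPolynomial.X (lo i) - MvPolynomial.X (hi i) : MvPolynomial (Fin n) ℤ) ∣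
        MvPolynomial.X k - MvPolynomial.X (simpleTransposition i k) := by
      unfold simpleTransposition
      by_cases h1 : k = lo i
      · subst h1; simp
      by_cases h2 : k = hi i
      · subst h2
        rw [Equiv.swap_apply_right]
        exact (dvd_neg.mpr dvd_rfl).trans (dvd_of_eq (neg_sub _ _))
      · simp [Equiv.swap_apply_of_ne_of_ne h1 h2]
    rw [map_mul, MvPolynomial.rename_X]
    have e : ∀ a b c d : MvPolynomial (Fin n) ℤ, a * b - c * d = (a - c) * b + c * (b - d) := by
      intros; ring
    rw [e]
    exact dvd_add (Dvd.dvd.mul_right hp _) (Dvd.dvd.mul_left hX _)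

/-- `∂_i f = (f - s_i f) / (x_i - x_{i+1})`, where `s_i` exchanges `x_i` and `x_{i+1}`. -/
noncomputable def simpleDividedDifference {n : ℕ} (i : Fin (n - 1))
    (f : MvPolynomial (Fin n) ℤ) : MvPolynomial (Fin n) ℤ :=
  Classical.choose (exists_quotient i f)

/-- The quotient is unique. -/
theorem simpleDividedDifference_eq_iff {n : ℕ} (i : Fin (n - 1))
    (f g : MvPolynomial (Fin n) ℤ) :
    simpleDividedDifference i f = g ↔
      f - MvPolynomial.rename (simpleTransposition i) f
        = (MvPolynomial.X (lo i) - MvPolynomial.X (hi i)) * g := by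
  have hs := Classical.choose_spec (exists_quotient i f)
  have h0 : (MvPolynomial.X (lo i) - MvPolynomial.X (hi i) : MvPolynomial (Fin n) ℤ) ≠ 0 :=
    sub_ne_zero.mpr fun h => lo_ne_hi i (MvPolynomial.X_injective h)
  constructor
  · rintro rfl; exact hs
  · intro h; exact mul_left_cancel₀ h0 (hs.symm.trans h)

/-- The composite `∂_{i_1} ∂_{i_2} ⋯ ∂_{i_r}` (the last letter acts first). -/
noncomputable def wordDividedDifference {n : ℕ} (a : List (Fin (n - 1)))
    (f : MvPolynomial (Fin n) ℤ) : MvPolynomial (Fin n) ℤ :=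
  a.foldr simpleDividedDifference f

/-- `∂_u = ∂_{i_1} ⋯ ∂_{i_r}` for a reduced word `s_{i_1} ⋯ s_{i_r}` of `u`. -/
noncomputable def dividedDifference {n : ℕ} (u : Equiv.Perm (Fin n))
    (f : MvPolynomial (Fin n) ℤ) : MvPolynomial (Fin n) ℤ :=
  wordDividedDifference (Classical.choose (exists_isReducedWord u)) f

/-- The monomial `x_2 x_3^2 ⋯ x_n^{n-1}`. -/
noncomputable def staircaseMonomial (n : ℕ) : MvPolynomial (Fin n) ℤ :=
  ∏ i : Fin n, MvPolynomial.X i ^ (i : ℕ)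

end YoungSchubert

/-! The proof follows Fomin and Stanley and takes place in the nilCoxeter algebra. Read the cells of
a pipe dream row by row from the top; a cross in the cell (r, c) multiplies the current permutation
on the right by the transposition (r + c, r + c + 1). The pipe dream is reduced exactly when every
such step increases the length (`isReduced_iff`), and all crosses then satisfy r + c + 1 < n
(`IsAscending.subset_staircase`), whence finiteness. Reduced pipe dreams are therefore the surviving
terms in the expansion of P = B_{n-1}(y_{n-1}) ⋯ B_0(y_0), where B_r(x) = (1 + x u_r) ⋯ (1 + x
u_{n-2}), and the Young Schubert polynomial is a coefficient of P (`coeffFrom_one`,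
`youngSchubert_eq`).

Because B_j(a) and B_j(b) commute (`IsNilCoxeter.chain_commute`), exchanging y_j and y_{j+1} lowers
P by (y_j - y_{j+1}) u_j P (`IsNilCoxeter.chainProd_sub_swap`). Comparing coefficients
(`coeffFrom_sub_swap`) shows that passing from w to a longer w s_i applies -∂_i; the sign appears
because rows are counted from the bottom and variables from the top.

For w = 1 the full staircase is the only pipe dream, and it contributes the staircase monomial
(`youngSchubert_one`). A reduced word of w⁻¹ builds w from 1 by length-increasing steps, so
induction on the word gives the formula for every reduced word. -/

namespace YoungSchubert

/-! ### Products in nilCoxeter algebras -/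

section NilCoxeter

variable {R A : Type*} [CommRing R] [Ring A] [Algebra R A]

/-- The relations of the nilCoxeter algebra on generators `u 0, u 1, …`. -/
structure IsNilCoxeter (u : ℕ → A) : Prop where
  sq : ∀ i, u i * u i = 0
  comm : ∀ i j, i + 2 ≤ j → u i * u j = u j * u i
  braid : ∀ i, u i * u (i + 1) * u i = u (i + 1) * u i * u (i + 1)

/-- The product `(1 + x u_r) (1 + x u_{r+1}) ⋯ (1 + x u_{r+m-1})`. -/
def chain (u : ℕ → A) (x : R) (r m : ℕ) : A :=
  ((List.range m).map fun c => 1 + x • u (r + c)).prod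

theorem chain_zero (u : ℕ → A) (x : R) (r : ℕ) : chain u x r 0 = 1 := rfl

theorem chain_succ (u : ℕ → A) (x : R) (r m : ℕ) :
    chain u x r (m + 1) = (1 + x • u r) * chain u x (r + 1) m := by
  simp only [chain, List.range_succ_eq_map, List.map_cons, List.prod_cons, List.map_map]
  congr 3
  ext c
  simp [Nat.add_right_comm, Nat.add_assoc]

variable {u : ℕ → A}

theorem IsNilCoxeter.commute_chain (hu : IsNilCoxeter u) (x : R) {i r : ℕ} (h : i + 2 ≤ r)
    (m : ℕ) : Commute (u i) (chain u x r m) := by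
  induction m generalizing r with
  | zero => exact Commute.one_right _
  | succ m ih =>
    rw [chain_succ]
    refine Commute.mul_right ?_ (ih (by omega))
    exact (Commute.one_right _).add_right (Commute.smul_right (hu.comm i r h) x)

/-- Moving the head `1 + b • u r` of the second chain leftwards through the first leaves a prefix
symmetric in `a` and `b`, times the same product of chains started at `r + 1`, to which induction
applies. -/
theorem IsNilCoxeter.chain_commute (hu : IsNilCoxeter u) (a b : R) (r m : ℕ) :
    chain u a r m * chain u b r m = chain u b r m * chain u a r m := by
  induction m generalizing r with
  | zero => rfl
  | succ m ih =>
    cases m with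
    | zero =>
      simp only [chain_succ, chain_zero, mul_one]
      simp only [mul_add, add_mul, one_mul, mul_one, smul_mul_smul_comm, hu.sq, smul_zero]
      abel
    | succ m =>
      have key : ∀ a b : R, chain u a r (m + 2) * chain u b r (m + 2) =
          (1 + (a + b) • u r + (a * b) • (u (r + 1) * u r - u r * u (r + 1))) *
            (chain u a (r + 1) (m + 1) * chain u b (r + 1) (m + 1)) := by
        intro a b
        -- Since `u (r + 1)` squares to zero, `1 - a • u (r + 1)` is inverse to the head of the
        -- chain.
        have h1 : chain u a (r + 2) m = (1 - a • u (r + 1)) * chain u a (r + 1) (m + 1) := by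
          rw [chain_succ, ← mul_assoc]
          simp [mul_add, sub_mul, hu.sq]
        have h2 : chain u a (r + 2) m * (1 + b • u r) = (1 + b • u r) * chain u a (r + 2) m :=
          ((Commute.one_right _).add_right
            ((hu.commute_chain a le_rfl m).symm.smul_right b)).eq
        have h3 : (1 + a • u r) * (1 + a • u (r + 1)) * (1 + b • u r) * (1 - a • u (r + 1)) =
            1 + (a + b) • u r + (a * b) • (u (r + 1) * u r - u r * u (r + 1)) := by
          have e1 := hu.sq r
          have e2 := hu.sq (r + 1)
          have e3 := hu.braid r
          have e4 : u r * u (r + 1) * u (r + 1) = 0 := by rw [mul_assoc, e2, mul_zero]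
          have e5 : u (r + 1) * u r * u (r + 1) * u (r + 1) = 0 := by
            rw [mul_assoc _ (u (r + 1)), e2, mul_zero]
          simp only [mul_add, add_mul, mul_sub, one_mul, mul_one, e1, e2, e3, e4, e5,
            smul_zero, zero_mul, smul_mul_assoc, mul_smul_comm]
          module
        calc chain u a r (m + 2) * chain u b r (m + 2)
            = (1 + a • u r) * (1 + a • u (r + 1)) * (chain u a (r + 2) m * (1 + b • u r)) *
                chain u b (r + 1) (m + 1) := by
              rw [chain_succ u a r, chain_succ u a (r + 1), chain_succ u b r]; noncomm_ring
          _ = (1 + a • u r) * (1 + a • u (r + 1)) * (1 + b • u r) * (1 - a • u (r + 1)) *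
                (chain u a (r + 1) (m + 1) * chain u b (r + 1) (m + 1)) := by
              rw [h2, h1]; noncomm_ring
          _ = _ := by rw [h3]
      rw [key a b, key b a, ih, add_comm a b, mul_comm a b]

/-- The product `B_{k-1}(y_{k-1}) ⋯ B_1(y_1) B_0(y_0)` with
`B_r(x) = (1 + x u_r) ⋯ (1 + x u_{N-2})`. -/
def chainProd (u : ℕ → A) (y : ℕ → R) (N : ℕ) : ℕ → A
  | 0 => 1
  | k + 1 => chain u (y k) k (N - 1 - k) * chainProd u y N k

theorem chainProd_congr (u : ℕ → A) {y z : ℕ → R} (N : ℕ) {k : ℕ} (h : ∀ r < k, y r = z r) :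
    chainProd u y N k = chainProd u z N k := by
  induction k with
  | zero => rfl
  | succ k ih => rw [chainProd, chainProd, ih fun r hr => h r (by omega), h k (by omega)]

/-- Writing B_{j+1}(a) B_j(b) = (1 - a u_j) B_j(a) B_j(b) isolates the asymmetry in the first
factor, the rest being symmetric by `chain_commute`. Multiplying by u_j kills the a-term, as u_j² =
0. The later factors, with index at least j + 2, commute with u_j. -/
theorem IsNilCoxeter.chainProd_sub_swap (hu : IsNilCoxeter u) (y : ℕ → R) {N j : ℕ}
    (hj : j + 2 ≤ N) {k : ℕ} (hk : j + 2 ≤ k) :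
    chainProd u y N k - chainProd u (y ∘ Equiv.swap j (j + 1)) N k =
      (y j - y (j + 1)) • (u j * chainProd u y N k) := by
  induction k, hk using Nat.le_induction with
  | base =>
    simp only [chainProd]
    rw [chainProd_congr u N (y := y ∘ Equiv.swap j (j + 1)) (z := y) fun r hr => by
      rw [Function.comp_apply, Equiv.swap_apply_of_ne_of_ne (by omega) (by omega)]]
    simp only [Function.comp_apply, Equiv.swap_apply_left, Equiv.swap_apply_right]
    obtain ⟨m, rfl⟩ : ∃ m, N = j + 2 + m := ⟨N - (j + 2), by omega⟩
    rw [show j + 2 + m - 1 - (j + 1) = m by omega, show j + 2 + m - 1 - j = m + 1 by omega]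
    have h : ∀ a b : R, chain u a (j + 1) m * (chain u b j (m + 1) * chainProd u y (j + 2 + m) j) =
        (1 - a • u j) * (chain u a j (m + 1) * chain u b j (m + 1)) *
          chainProd u y (j + 2 + m) j := by
      intro a b
      have h1 : chain u a (j + 1) m = (1 - a • u j) * chain u a j (m + 1) := by
        rw [chain_succ, ← mul_assoc]
        simp [mul_add, sub_mul, hu.sq]
      rw [h1]; noncomm_ring
    rw [h, h, hu.chain_commute (y j) (y (j + 1))]
    rw [← mul_assoc (u j), ← mul_assoc (u j), mul_sub, mul_smul_comm, hu.sq, smul_zero, sub_zero,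
      mul_one, ← sub_mul, ← sub_mul, sub_sub_sub_cancel_left, ← sub_smul, smul_mul_assoc,
      smul_mul_assoc]
  | succ k hk ih =>
    simp only [chainProd]
    rw [Function.comp_apply, Equiv.swap_apply_of_ne_of_ne (by omega) (by omega), ← mul_sub, ih,
      mul_smul_comm, ← mul_assoc, ← mul_assoc, (hu.commute_chain (y k) hk _).eq]

theorem commute_chainProd {a : A} (h : ∀ i, Commute a (u i)) (y : ℕ → R) (N k : ℕ) :
    Commute a (chainProd u y N k) := by
  induction k with
  | zero => exact Commute.one_right _
  | succ k ih =>
    refine Commute.mul_right (Commute.list_prod_right _ _ fun b hb => ?_) ih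
    obtain ⟨c, -, rfl⟩ := List.mem_map.mp hb
    exact (Commute.one_right _).add_right ((h _).smul_right _)

end NilCoxeter

/-! ### The nilCoxeter algebra acting on functions on permutations -/

/-- The transposition `(j, j + 1)` of `ℕ`. -/
def adj (j : ℕ) : Equiv.Perm ℕ := Equiv.swap j (j + 1)

theorem adj_apply (j k : ℕ) : adj j k = if k = j then j + 1 else if k = j + 1 then j else k :=
  Equiv.swap_apply_def _ _ _

theorem adj_mul_self (j : ℕ) : adj j * adj j = 1 := Equiv.swap_mul_self _ _

theorem adj_lt_adj {j a b : ℕ} (h : ¬(a = j ∧ b = j + 1)) (h' : ¬(a = j + 1 ∧ b = j)) :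
    adj j a < adj j b ↔ a < b := by
  rw [adj_apply, adj_apply]
  split_ifs <;> omega

section Operators

variable (R : Type*) [CommRing R]

/-- The operator of right multiplication by `(j, j + 1)` in the length-increasing direction. -/
def rightOp (j : ℕ) : Module.End R (Equiv.Perm ℕ → R) where
  toFun f τ := if τ j < τ (j + 1) then f (τ * adj j) else 0
  map_add' f g := by ext τ; simp only [Pi.add_apply]; split_ifs <;> simp
  map_smul' a f := by ext τ; simp

/-- The operator of left multiplication by `(j, j + 1)` in the length-increasing direction. -/
def leftOp (j : ℕ) : Module.End R (Equiv.Perm ℕ → R) where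
  toFun f τ := if τ⁻¹ j < τ⁻¹ (j + 1) then f (adj j * τ) else 0
  map_add' f g := by ext τ; simp only [Pi.add_apply]; split_ifs <;> simp
  map_smul' a f := by ext τ; simp

variable {R}

theorem rightOp_apply (j : ℕ) (f : Equiv.Perm ℕ → R) (τ : Equiv.Perm ℕ) :
    rightOp R j f τ = if τ j < τ (j + 1) then f (τ * adj j) else 0 := rfl

theorem leftOp_apply (j : ℕ) (f : Equiv.Perm ℕ → R) (τ : Equiv.Perm ℕ) :
    leftOp R j f τ = if τ⁻¹ j < τ⁻¹ (j + 1) then f (adj j * τ) else 0 := rfl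

theorem isNilCoxeter_rightOp : IsNilCoxeter (rightOp R) where
  sq i := by
    ext f τ
    simp only [Module.End.mul_apply, rightOp_apply, Equiv.Perm.mul_apply, adj_apply]
    simp
    intro h h'
    omega
  comm i j h := by
    ext f τ
    simp only [Module.End.mul_apply, rightOp_apply, Equiv.Perm.mul_apply, mul_assoc]
    have h1 : adj i * adj j = adj j * adj i := by
      ext k; simp only [Equiv.Perm.mul_apply, adj_apply]; split_ifs <;> omega
    have e1 : adj i j = j := by rw [adj_apply]; split_ifs <;> omega
    have e2 : adj i (j + 1) = j + 1 := by rw [adj_apply]; split_ifs <;> omega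
    have e3 : adj j i = i := by rw [adj_apply]; split_ifs <;> omega
    have e4 : adj j (i + 1) = i + 1 := by rw [adj_apply]; split_ifs <;> omega
    rw [h1, e1, e2, e3, e4]
    split_ifs <;> rfl
  braid i := by
    ext f τ
    simp only [Module.End.mul_apply, rightOp_apply, Equiv.Perm.mul_apply, mul_assoc]
    have h1 : adj i * (adj (i + 1) * adj i) = adj (i + 1) * (adj i * adj (i + 1)) := by
      ext k; simp only [Equiv.Perm.mul_apply, adj_apply]; split_ifs <;> omega
    rw [h1]
    simp only [adj_apply]
    simp
    -- On either side the three conditions together say that τ is increasing on i, i + 1, i + 2.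
    split_ifs <;> first | rfl | omega

/-- If τ maps {i, i + 1} onto {j, j + 1}, both composites vanish, since the two multiplications undo
each other. Otherwise neither exchange affects the condition of the other. -/
theorem commute_leftOp_rightOp (j i : ℕ) : Commute (leftOp R j) (rightOp R i) := by
  have hc : ∀ τ : Equiv.Perm ℕ, (τ⁻¹ j < τ⁻¹ (j + 1) ∧ adj j (τ i) < adj j (τ (i + 1))) ↔
      (τ i < τ (i + 1) ∧ adj i (τ⁻¹ j) < adj i (τ⁻¹ (j + 1))) := by
    intro τ
    have h : ∀ a b, τ a = b ↔ τ⁻¹ b = a := fun a b => by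
      rw [Equiv.Perm.inv_eq_iff_eq]; exact eq_comm
    have n1 : τ i ≠ τ (i + 1) := fun e => by simpa using τ.injective e
    have n2 : τ⁻¹ j ≠ τ⁻¹ (j + 1) := fun e => by simpa using τ⁻¹.injective e
    by_cases c1 : τ i = j ∧ τ (i + 1) = j + 1
    · have c2 := (h _ _).mp c1.1
      have c3 := (h _ _).mp c1.2
      rw [c1.1, c1.2, c2, c3]
      simp [adj_apply]
    by_cases c2 : τ i = j + 1 ∧ τ (i + 1) = j
    · have c3 := (h _ _).mp c2.1
      have c4 := (h _ _).mp c2.2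
      rw [c2.1, c2.2, c3, c4]
      simp [adj_apply]
    rw [adj_lt_adj c1 c2, adj_lt_adj (by rwa [← h, ← h])
      (by rw [← h, ← h]; rwa [and_comm] at c2), and_comm]
  ext f τ
  simp only [Module.End.mul_apply, rightOp_apply, leftOp_apply, mul_assoc, ← ite_and,
    Equiv.Perm.mul_apply, mul_inv_rev]
  have e : (adj i)⁻¹ = adj i := inv_eq_of_mul_eq_one_left (adj_mul_self i)
  rw [e]
  exact if_congr (hc τ) rfl rfl

open Classical in
/-- The coefficient of `σ` in the product `chainProd` of the operators, as a function of the
starting permutation. -/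
noncomputable def coeffFrom (y : ℕ → R) (N : ℕ) (σ : Equiv.Perm ℕ) : Equiv.Perm ℕ → R :=
  chainProd (rightOp R) y N N (Pi.single σ 1)

-- At the identity, right and left multiplication by `adj j` agree, so the factor u_j may be
-- replaced by `leftOp`. This commutes past the whole product and, by `hσ`, turns the indicator of σ
-- into that of `adj j * σ`.
open Classical in
theorem coeffFrom_sub_swap (y : ℕ → R) {N j : ℕ} (hj : j + 2 ≤ N) {σ : Equiv.Perm ℕ}
    (hσ : σ⁻¹ (j + 1) < σ⁻¹ j) :
    coeffFrom y N σ 1 - coeffFrom (y ∘ Equiv.swap j (j + 1)) N σ 1 =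
      (y j - y (j + 1)) * coeffFrom y N (adj j * σ) 1 := by
  have h1 := congrArg (fun T : Module.End R (Equiv.Perm ℕ → R) => T (Pi.single σ 1) 1)
    (isNilCoxeter_rightOp.chainProd_sub_swap y hj hj)
  simp only [LinearMap.sub_apply, Pi.sub_apply, LinearMap.smul_apply, Pi.smul_apply, smul_eq_mul,
    Module.End.mul_apply] at h1
  have e : (adj j)⁻¹ = adj j := inv_eq_of_mul_eq_one_left (adj_mul_self j)
  have h2 : leftOp R j (Pi.single σ 1) = Pi.single (adj j * σ) 1 := by
    ext τ
    rw [leftOp_apply]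
    by_cases c : τ = adj j * σ
    · subst c
      rw [← mul_assoc, adj_mul_self, one_mul, Pi.single_eq_same, Pi.single_eq_same, if_pos]
      rw [mul_inv_rev, e]
      simpa [adj_apply] using hσ
    · rw [Pi.single_eq_of_ne c, Pi.single_eq_of_ne, ite_self]
      rintro rfl
      exact c (by rw [← mul_assoc, adj_mul_self, one_mul])
  have h3 := congrArg (fun T : Module.End R (Equiv.Perm ℕ → R) => T (Pi.single σ 1) 1)
    (commute_chainProd (commute_leftOp_rightOp (R := R) j) y N N).eq
  simp only [Module.End.mul_apply, h2, leftOp_apply, inv_one, Equiv.Perm.one_apply,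
    Nat.lt_succ_self, if_true, mul_one] at h3
  unfold coeffFrom
  rw [h1, ← h3, rightOp_apply]
  simp

end Operators


/-! ### The permutations met while reading a pipe dream

Cells are read row by row from the top, each row from left to right.  A cross in the cell `(r, c)`
exchanges the entries at the positions `r + c` and `r + c + 1`, which are the pipes entering the
cell from the left and from the top. -/

/-- The effect of the first `m` cells of the row `r` on the permutation `τ`. -/
def rowState (D : Finset (ℕ × ℕ)) (τ : Equiv.Perm ℕ) (r : ℕ) : ℕ → Equiv.Perm ℕ
  | 0 => τ
  | m + 1 => if (r, m) ∈ D then rowState D τ r m * adj (r + m) else rowState D τ r m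

/-- The permutation after the rows `r, …, r + k - 1`, of which the row `i` has `M - 1 - i` cells. -/
def rowsState (D : Finset (ℕ × ℕ)) (M : ℕ) : ℕ → ℕ → Equiv.Perm ℕ
  | _, 0 => 1
  | r, k + 1 => rowState D (rowsState D M (r + 1) k) r (M - 1 - r)

/-- The permutation after all the rows from `r` upwards. -/
def stateAbove (D : Finset (ℕ × ℕ)) (M r : ℕ) : Equiv.Perm ℕ := rowsState D M r (M - r)

/-- The permutation before the cell `(r, c)`. -/
def state (D : Finset (ℕ × ℕ)) (M r c : ℕ) : Equiv.Perm ℕ := rowState D (stateAbove D M (r + 1)) r c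

/-- The cells `(r, c)` with `r + c + 1 < n`. -/
def staircase (n : ℕ) : Finset (ℕ × ℕ) :=
  (Finset.range n ×ˢ Finset.range n).filter fun x => x.1 + x.2 + 1 < n

theorem mem_staircase {n r c : ℕ} : (r, c) ∈ staircase n ↔ r + c + 1 < n := by
  simp only [staircase, Finset.mem_filter, Finset.mem_product, Finset.mem_range]
  omega

section

variable {D : Finset (ℕ × ℕ)} {M : ℕ}

theorem stateAbove_of_le {r : ℕ} (h : M ≤ r) : stateAbove D M r = 1 := by
  rw [stateAbove, Nat.sub_eq_zero_of_le h, rowsState]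

theorem stateAbove_of_lt {r : ℕ} (h : r < M) : stateAbove D M r = state D M r (M - 1 - r) := by
  rw [state, stateAbove, stateAbove, show M - r = (M - (r + 1)) + 1 by omega, rowsState]

theorem state_zero (r : ℕ) : state D M r 0 = stateAbove D M (r + 1) := rfl

theorem state_succ_of_mem {r c : ℕ} (h : (r, c) ∈ D) :
    state D M r (c + 1) = state D M r c * adj (r + c) := by
  rw [state, rowState, if_pos h, state]

theorem state_succ_of_notMem {r c : ℕ} (h : (r, c) ∉ D) :
    state D M r (c + 1) = state D M r c := by
  rw [state, rowState, if_neg h, state]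

theorem state_eq_of_le (hD : D ⊆ staircase M) {r c c' : ℕ} (h : M - 1 - r ≤ c) (h' : c ≤ c') :
    state D M r c' = state D M r c := by
  induction c', h' using Nat.le_induction with
  | base => rfl
  | succ k hk ih =>
    rw [state_succ_of_notMem, ih]
    intro hm
    have := mem_staircase.mp (hD hm)
    omega

theorem stateAbove_eq_state (hD : D ⊆ staircase M) {r c : ℕ} (hr : r < M) (h : M - 1 - r ≤ c) :
    stateAbove D M r = state D M r c := by
  rw [stateAbove_of_lt hr, state_eq_of_le hD le_rfl h]

theorem state_of_le (hD : D ⊆ staircase M) {r c : ℕ} (h : M ≤ r) : state D M r c = 1 := by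
  rw [state_eq_of_le hD (c := 0) (by omega) (Nat.zero_le _), state_zero,
    stateAbove_of_le (by omega)]

/-- Induction along the reading order of the cells. -/
theorem reading_induction (M : ℕ) {P : ℕ → ℕ → Prop} (h0 : ∀ r c, M ≤ r → P r c)
    (hs : ∀ r c, P r c → P r (c + 1)) (hr : ∀ r, r < M → (∀ e, P (r + 1) e) → P r 0) (r c : ℕ) :
    P r c := by
  induction hk : M - r generalizing r c with
  | zero => exact h0 r c (by omega)
  | succ k ih =>
    induction c with
    | zero => exact hr r (by omega) fun e => ih (r + 1) e (by omega)
    | succ c ihc => exact hs r c ihc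

/-- At a change of row, any column `e` past the end of the row above may be used: only elbows lie
there, so the state is constant. -/
theorem state_step (hD : D ⊆ staircase M) {Q : ℕ → ℕ → Equiv.Perm ℕ → Prop}
    (h0 : ∀ r c, M ≤ r → Q r c 1)
    (hcross : ∀ r c τ, τ = state D M r c → (r, c) ∈ D → Q r c τ → Q r (c + 1) (τ * adj (r + c)))
    (helbow : ∀ r c τ, (r, c) ∉ D → Q r c τ → Q r (c + 1) τ)
    (hr : ∀ r τ, r < M → (∀ e, M - 1 - (r + 1) ≤ e → Q (r + 1) e τ) → Q r 0 τ) (r c : ℕ) :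
    Q r c (state D M r c) := by
  refine reading_induction M (P := fun r c => Q r c (state D M r c)) ?_ ?_ ?_ r c
  · intro r c h
    rw [state_of_le hD h]
    exact h0 r c h
  · intro r c h
    by_cases hc : (r, c) ∈ D
    · rw [state_succ_of_mem hc]; exact hcross r c _ rfl hc h
    · rw [state_succ_of_notMem hc]; exact helbow r c _ hc h
  · intro r h hQ
    refine hr r _ h fun e he => ?_
    have := hQ e
    rw [state_zero]
    by_cases hM : r + 1 < M
    · rwa [stateAbove_eq_state hD hM he]
    · rw [stateAbove_of_le (by omega)]
      rwa [state_of_le hD (by omega)] at this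

theorem state_apply_of_lt (hD : D ⊆ staircase M) (r c : ℕ) : ∀ k < r, state D M r c k = k := by
  refine state_step hD (Q := fun r _ τ => ∀ k < r, τ k = k) ?_ ?_ ?_ ?_ r c
  · intro r c _ k _; rfl
  · intro r c τ _ _ h k hk
    rw [Equiv.Perm.mul_apply, adj_apply, if_neg (by omega), if_neg (by omega), h k hk]
  · intro r c τ _ h; exact h
  · intro r τ _ h k hk; exact h _ le_rfl k (by omega)

theorem state_apply_of_le {r c k c' : ℕ} (h : c ≤ c') (hk : k < r + c) :
    state D M r c' k = state D M r c k := by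
  induction c', h using Nat.le_induction with
  | base => rfl
  | succ m hm ih =>
    by_cases hc : (r, m) ∈ D
    · rw [state_succ_of_mem hc, Equiv.Perm.mul_apply, adj_apply, if_neg (by omega),
        if_neg (by omega), ih]
    · rw [state_succ_of_notMem hc, ih]

theorem state_apply_of_gt {r c k : ℕ} (hk : r + c < k) :
    state D M r c k = state D M r 0 k := by
  induction c with
  | zero => rfl
  | succ m ih =>
    by_cases hc : (r, m) ∈ D
    · rw [state_succ_of_mem hc, Equiv.Perm.mul_apply, adj_apply, if_neg (by omega),
        if_neg (by omega), ih (by omega)]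
    · rw [state_succ_of_notMem hc, ih (by omega)]

/-- Position r + c is touched in row r only by the cells in columns c - 1 and c, so its entry is
settled after c + 1 cells. -/
theorem stateAbove_apply (hD : D ⊆ staircase M) (r c : ℕ) :
    stateAbove D M r (r + c) = state D M r (c + 1) (r + c) := by
  by_cases hr : r < M
  · rcases le_total (M - 1 - r) (c + 1) with h | h
    · rw [stateAbove_eq_state hD hr h]
    · rw [stateAbove_of_lt hr, state_apply_of_le h (by omega)]
  · rw [stateAbove_of_le (by omega), state_of_le hD (by omega)]

theorem state_apply_top (hD : D ⊆ staircase M) (r c : ℕ) :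
    state D M r c (r + c + 1) = state D M (r + 1) (c + 1) (r + 1 + c) := by
  rw [state_apply_of_gt (by omega), state_zero, ← stateAbove_apply hD, Nat.add_right_comm]

/-! ### Pipes as entries of the states -/

/-- The position of the pipe entering through a side, relative to that on the left. -/
def Side.offset : Side → ℕ
  | .left => 0
  | .top => 1

theorem state_zero_apply (hD : D ⊆ staircase M) (r : ℕ) : state D M r 0 r = r := by
  rw [state_zero]
  by_cases hp : r + 1 < M
  · rw [stateAbove_of_lt hp, state_apply_of_lt hD _ _ _ (by omega)]
  · rw [stateAbove_of_le (by omega)]; rfl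

theorem state_of_enters (hD : D ⊆ staircase M) {p r c : ℕ} {s : Side} (h : Enters D p r c s) :
    state D M r c (r + c + s.offset) = p := by
  induction h with
  | start => exact state_zero_apply hD p
  | cross_right r c hm _ ih =>
    rw [state_succ_of_mem hm, Equiv.Perm.mul_apply, ← ih]
    simp [Side.offset, adj_apply, Nat.add_assoc]
  | cross_down r c hm _ ih =>
    simp only [Side.offset] at ih ⊢
    rw [state_apply_top hD, state_succ_of_mem hm, Equiv.Perm.mul_apply, adj_apply, if_pos rfl, ih]
  | elbow_right r c hm _ ih =>
    rw [state_succ_of_notMem hm, ← ih]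
    rfl
  | elbow_down r c hm _ ih =>
    simp only [Side.offset] at ih ⊢
    rw [state_apply_top hD, state_succ_of_notMem hm]
    exact ih

theorem enters_top_of_left {r c : ℕ} (hD : D ⊆ staircase M)
    (hl : Enters D (state D M (r + 1) c (r + 1 + c)) (r + 1) c .left)
    (ht : Enters D (state D M (r + 1) c (r + 1 + c + 1)) (r + 1) c .top) :
    Enters D (state D M r c (r + c + 1)) r c .top := by
  rw [state_apply_top hD]
  by_cases hm : (r + 1, c) ∈ D
  · rw [state_succ_of_mem hm, Equiv.Perm.mul_apply, adj_apply, if_pos rfl]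
    exact .cross_down r c hm ht
  · rw [state_succ_of_notMem hm]
    exact .elbow_down r c hm hl

theorem enters_left_succ {r c : ℕ}
    (hl : Enters D (state D M r c (r + c)) r c .left)
    (ht : Enters D (state D M r c (r + c + 1)) r c .top) :
    Enters D (state D M r (c + 1) (r + (c + 1))) r (c + 1) .left := by
  by_cases hm : (r, c) ∈ D
  · rw [state_succ_of_mem hm, Equiv.Perm.mul_apply, adj_apply, if_neg (by omega),
      if_pos (by omega)]
    exact .cross_right r c hm hl
  · rw [state_succ_of_notMem hm]
    exact .elbow_right r c hm ht

/-- There is no topmost row to start from, so the induction is on the column. Only elbows occur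
here, and pipe p zigzags with its left entries on the antidiagonal r + c = p. -/
theorem enters_of_le (hD : D ⊆ staircase M) {r : ℕ} (hr : M ≤ r) (c : ℕ) :
    Enters D (r + c) r c .left ∧ Enters D (r + c + 1) r c .top := by
  have hm : ∀ r c, M ≤ r → (r, c) ∉ D := fun r c h hc => by
    have := mem_staircase.mp (hD hc); omega
  have htop : ∀ r c, M ≤ r → Enters D (r + 1 + c) (r + 1) c .left →
      Enters D (r + c + 1) r c .top := fun r c h hl => by
    rw [Nat.add_right_comm]
    exact .elbow_down r c (hm _ _ (by omega)) hl
  have hleft : ∀ r, M ≤ r → Enters D (r + c) r c .left := by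
    induction c with
    | zero => exact fun r _ => .start
    | succ c ih => exact fun r h =>
        .elbow_right r c (hm r c h) (htop r c h (ih (r + 1) (by omega)))
  exact ⟨hleft r hr, htop r c hr (hleft (r + 1) (by omega))⟩

/-- The induction goes down the rows and, within a row, to the right: the top entry comes from the
row above, the left entry from the preceding cell. -/
theorem enters_state (hD : D ⊆ staircase M) (r c : ℕ) :
    Enters D (state D M r c (r + c)) r c .left ∧
      Enters D (state D M r c (r + c + 1)) r c .top := by
  induction hk : M - r generalizing r c with
  | zero =>
    rw [state_of_le hD (by omega)]
    exact enters_of_le hD (by omega) c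
  | succ k ih =>
    have htop : ∀ c, Enters D (state D M r c (r + c + 1)) r c .top := fun c =>
      have := ih (r + 1) c (by omega)
      enters_top_of_left hD this.1 this.2
    refine ⟨?_, htop c⟩
    induction c with
    | zero => rw [Nat.add_zero, state_zero_apply hD]; exact .start
    | succ c ihc => exact enters_left_succ ihc (htop c)

theorem enters_left_iff (hD : D ⊆ staircase M) {p r c : ℕ} :
    Enters D p r c .left ↔ state D M r c (r + c) = p :=
  ⟨state_of_enters hD, fun h => h ▸ (enters_state hD r c).1⟩

theorem enters_top_iff (hD : D ⊆ staircase M) {p r c : ℕ} :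
    Enters D p r c .top ↔ state D M r c (r + c + 1) = p :=
  ⟨state_of_enters hD, fun h => h ▸ (enters_state hD r c).2⟩

/-- The final state sends a column to the pipe ending there, hence is the inverse of the permutation
of the pipe dream. -/
theorem exits_iff (hD : D ⊆ staircase M) {p c : ℕ} : Exits D p c ↔ stateAbove D M 0 c = p := by
  have h := stateAbove_apply hD 0 c
  rw [Nat.zero_add] at h
  rw [Exits, enters_left_iff hD, enters_top_iff hD, h, Nat.zero_add]
  by_cases hm : (0, c) ∈ D
  · simp [hm, state_succ_of_mem hm, adj_apply]
  · simp [hm, state_succ_of_notMem hm]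

theorem crossAt_iff (hD : D ⊆ staircase M) {p q r c : ℕ} :
    CrossAt D p q (r, c) ↔ (r, c) ∈ D ∧
      ((state D M r c (r + c) = p ∧ state D M r c (r + c + 1) = q) ∨
        (state D M r c (r + c + 1) = p ∧ state D M r c (r + c) = q)) := by
  rw [CrossAt, enters_left_iff hD, enters_left_iff hD, enters_top_iff hD, enters_top_iff hD]

/-! ### Reducedness as increase of length -/

/-- Every cross exchanges two entries in increasing order. -/
def IsAscending (D : Finset (ℕ × ℕ)) (M : ℕ) : Prop :=
  ∀ r c, (r, c) ∈ D → state D M r c (r + c) < state D M r c (r + c + 1)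

theorem inv_mul_adj (τ : Equiv.Perm ℕ) (j a : ℕ) : (τ * adj j)⁻¹ a = adj j (τ⁻¹ a) := by
  rw [mul_inv_rev, inv_eq_of_mul_eq_one_left (adj_mul_self j)]; rfl

/-- The pipes start in increasing order, and only a cross exchanging these two can change their
relative order. -/
theorem crossAt_of_inverted (hD : D ⊆ staircase M) {a b : ℕ} (hab : a < b) (r c : ℕ) :
    (state D M r c)⁻¹ b < (state D M r c)⁻¹ a →
      ∃ x : ℕ × ℕ, (r < x.1 ∨ r = x.1 ∧ x.2 < c) ∧ CrossAt D a b x := by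
  refine state_step hD (Q := fun r c τ => τ⁻¹ b < τ⁻¹ a →
      ∃ x : ℕ × ℕ, (r < x.1 ∨ r = x.1 ∧ x.2 < c) ∧ CrossAt D a b x) ?_ ?_ ?_ ?_ r c
  · intro r c _ h
    simp only [inv_one, Equiv.Perm.one_apply] at h
    omega
  · intro r c τ hτ hm ih h
    rw [inv_mul_adj, inv_mul_adj] at h
    by_cases h' : τ⁻¹ b < τ⁻¹ a
    · obtain ⟨x, hx, hc⟩ := ih h'
      exact ⟨x, by omega, hc⟩
    · have hne : τ⁻¹ b ≠ τ⁻¹ a := fun e => by have := τ⁻¹.injective e; omega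
      have key : τ⁻¹ a = r + c ∧ τ⁻¹ b = r + c + 1 := by
        rw [adj_apply, adj_apply] at h
        split_ifs at h <;> omega
      refine ⟨(r, c), by simp, (crossAt_iff hD).mpr ⟨hm, Or.inl ?_⟩⟩
      rw [← hτ, ← key.2, ← key.1]
      simp
  · intro r c τ _ ih h
    obtain ⟨x, hx, hc⟩ := ih h
    exact ⟨x, by omega, hc⟩
  · intro r τ _ ih h
    obtain ⟨x, hx, hc⟩ := ih _ le_rfl h
    exact ⟨x, by omega, hc⟩

/-- A property of permutations kept by increasing exchanges persists along the reading order. -/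
theorem IsAscending.persist (hD : D ⊆ staircase M) (ha : IsAscending D M)
    {Q : Equiv.Perm ℕ → Prop} (hQ : ∀ τ j, τ j < τ (j + 1) → Q τ → Q (τ * adj j))
    {r c : ℕ} (h : Q (state D M r c)) (hr : r < M) (r' c' : ℕ) :
    (r' < r ∨ r' = r ∧ c ≤ c') → Q (state D M r' c') := by
  refine reading_induction M (P := fun r' c' => (r' < r ∨ r' = r ∧ c ≤ c') → Q (state D M r' c'))
    ?_ ?_ ?_ r' c'
  · intro r' c' h1 h2; omega
  · intro r' c' ih h1
    by_cases h2 : r' = r ∧ c = c' + 1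
    · rwa [h2.1, ← h2.2]
    · have := ih (by omega)
      by_cases hm : (r', c') ∈ D
      · rw [state_succ_of_mem hm]; exact hQ _ _ (ha _ _ hm) this
      · rwa [state_succ_of_notMem hm]
  · intro r' h1 ih h2
    by_cases h3 : r' = r ∧ c = 0
    · rwa [h3.1, ← h3.2]
    · rw [state_zero, stateAbove_eq_state (c := max c M) hD (by omega) (by omega)]
      exact ih _ (by omega)

theorem IsAscending.persist_final (hD : D ⊆ staircase M) (ha : IsAscending D M)
    {Q : Equiv.Perm ℕ → Prop} (hQ : ∀ τ j, τ j < τ (j + 1) → Q τ → Q (τ * adj j))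
    {r c : ℕ} (h : Q (state D M r c)) (hr : r < M) : Q (stateAbove D M 0) := by
  rw [stateAbove_eq_state (c := max c M) hD (by omega) (by omega)]
  exact ha.persist hD hQ h hr _ _ (by omega)

theorem inv_lt_inv_mul_adj {p q : ℕ} (hpq : p < q) (τ : Equiv.Perm ℕ) (j : ℕ)
    (hj : τ j < τ (j + 1)) (h : τ⁻¹ q < τ⁻¹ p) : (τ * adj j)⁻¹ q < (τ * adj j)⁻¹ p := by
  rw [inv_mul_adj, inv_mul_adj]
  have : ¬(τ⁻¹ q = j ∧ τ⁻¹ p = j + 1) := by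
    rintro ⟨h1, h2⟩
    rw [← h2, ← h1, Equiv.Perm.coe_inv, Equiv.apply_symm_apply, Equiv.apply_symm_apply] at hj
    omega
  rw [adj_apply, adj_apply]
  split_ifs <;> omega

theorem CrossAt.symm {p q : ℕ} {x : ℕ × ℕ} (h : CrossAt D p q x) : CrossAt D q p x :=
  ⟨h.1, h.2.symm.imp And.symm And.symm⟩

theorem IsAscending.of_crossAt (hD : D ⊆ staircase M) (ha : IsAscending D M) {p q r c : ℕ}
    (hpq : p < q) (h : CrossAt D p q (r, c)) :
    state D M r c (r + c) = p ∧ state D M r c (r + c + 1) = q := by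
  obtain ⟨hm, h | h⟩ := (crossAt_iff hD).mp h
  · exact h
  · have := ha r c hm
    omega

/-- A descending cross exchanges two pipes that are already inverted, hence crossed before.
Conversely, under ascending exchanges a pair that has crossed stays inverted and cannot be exchanged
again. -/
theorem isReduced_iff (hD : D ⊆ staircase M) : IsReduced D ↔ IsAscending D M := by
  constructor
  · intro h r c hm
    by_contra hlt
    have hne : state D M r c (r + c) ≠ state D M r c (r + c + 1) := fun e => by
      simpa using (state D M r c).injective e
    obtain ⟨x, hx, hc⟩ := crossAt_of_inverted hD
      (a := state D M r c (r + c + 1)) (b := state D M r c (r + c)) (by omega) r c (by simp)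
    have := h _ _ hne.symm x (r, c) hc ((crossAt_iff hD).mpr ⟨hm, Or.inr ⟨rfl, rfl⟩⟩)
    subst this
    omega
  · intro ha
    have key : ∀ p q, p < q → ∀ r c r' c', (r' < r ∨ r' = r ∧ c + 1 ≤ c') →
        CrossAt D p q (r, c) → CrossAt D p q (r', c') → False := by
      intro p q hpq r c r' c' hlt hx hy
      obtain ⟨x1, x2⟩ := ha.of_crossAt hD hpq hx
      obtain ⟨y1, y2⟩ := ha.of_crossAt hD hpq hy
      have hr := mem_staircase.mp (hD hx.1)
      have h0 : (state D M r (c + 1))⁻¹ q < (state D M r (c + 1))⁻¹ p := by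
        rw [state_succ_of_mem hx.1, inv_mul_adj, inv_mul_adj, ← x1, ← x2]
        simp [adj_apply]
      have h1 := ha.persist hD (Q := fun τ => τ⁻¹ q < τ⁻¹ p) (inv_lt_inv_mul_adj hpq) h0
        (by omega) r' c' hlt
      rw [← y1, ← y2] at h1
      simp at h1
    have key2 : ∀ p q, p < q → ∀ x y, CrossAt D p q x → CrossAt D p q y → x = y := by
      rintro p q hpq ⟨r, c⟩ ⟨r', c'⟩ hx hy
      by_contra hne
      rw [Prod.mk.injEq] at hne
      by_cases hlt : r' < r ∨ r' = r ∧ c + 1 ≤ c'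
      · exact key p q hpq r c r' c' hlt hx hy
      · exact key p q hpq r' c' r c (by omega) hy hx
    intro p q hne x y hx hy
    rcases lt_or_gt_of_ne hne with h | h
    · exact key2 p q h x y hx hy
    · exact key2 q p h x y hx.symm hy.symm

/-- A cross in (r, c) creates an inversion straddling the cut between positions r + c and r + c + 1.
Ascending exchanges preserve the existence of such an inversion, but a permutation fixing everything
from n on has none when the cut is at n or beyond. -/
theorem IsAscending.subset_staircase (hD : D ⊆ staircase M) (ha : IsAscending D M) {n : ℕ}
    (hn : ∀ k, n ≤ k → stateAbove D M 0 k = k) : D ⊆ staircase n := by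
  rintro ⟨r, c⟩ hm
  rw [mem_staircase]
  by_contra hlt
  obtain ⟨p, hp, q, hq, hpq⟩ := ha.persist_final hD (r := r) (c := c + 1)
    (Q := fun τ => ∃ p, p < r + c + 1 ∧ ∃ q, r + c + 1 ≤ q ∧ τ q < τ p) (by
      rintro τ j hj ⟨p, hp, q, hq, hpq⟩
      by_cases h : j = r + c
      · subst h
        refine ⟨r + c, by omega, r + c + 1, le_rfl, ?_⟩
        simpa [adj_apply] using hj
      · refine ⟨adj j p, ?_, adj j q, ?_, ?_⟩
        · rw [adj_apply]; split_ifs <;> omega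
        · rw [adj_apply]; split_ifs <;> omega
        · rw [← Equiv.Perm.mul_apply, ← Equiv.Perm.mul_apply, mul_assoc, adj_mul_self]
          exact hpq)
    ⟨r + c, by omega, r + c + 1, le_rfl, by
      rw [state_succ_of_mem hm]; simpa [adj_apply] using ha r c hm⟩
    (by have := mem_staircase.mp (hD hm); omega)
  rw [hn q (by omega)] at hpq
  -- The value at p is at least n, hence a fixed point; injectivity then forces it to equal p, which
  -- lies below the cut.
  have := (stateAbove D M 0).injective (hn (stateAbove D M 0 p) (by omega))
  omega

theorem stateAbove_apply_of_le (hD : D ⊆ staircase M) (k : ℕ) (hk : M ≤ k) :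
    stateAbove D M 0 k = k := by
  by_cases hM : 0 < M
  · rw [stateAbove_of_lt hM]
    refine state_step hD (Q := fun _ _ τ => τ k = k) ?_ ?_ ?_ ?_ _ _
    · intros; rfl
    · intro r c τ _ hm h
      have := mem_staircase.mp (hD hm)
      rw [Equiv.Perm.mul_apply, adj_apply, if_neg (by omega), if_neg (by omega), h]
    · intro r c τ _ h; exact h
    · intro r τ _ h; exact h _ le_rfl
  · rw [stateAbove_of_le (by omega)]; rfl

/-! ### The full staircase -/

/-- The rows above r have reversed the labels r + 1, …, n - 1; row r carries the label r rightwards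
past all of them. -/
theorem state_staircase (n r c : ℕ) : c ≤ n - 1 - r → ∀ k < n,
    state (staircase n) n r c k = if k < r then k else if k < r + c then n - 1 + r - k else
      if k = r + c then r else n + r - k := by
  refine state_step (D := staircase n) (M := n) subset_rfl (Q := fun r c τ => c ≤ n - 1 - r →
    ∀ k < n, τ k = if k < r then k else if k < r + c then n - 1 + r - k else
      if k = r + c then r else n + r - k) ?_ ?_ ?_ ?_ r c
  · intro r c h h1 k h2
    rw [if_pos (by omega)]; rfl
  · intro r c τ _ hm ih hc k hk
    have ih := ih (by omega)
    rw [Equiv.Perm.mul_apply, adj_apply]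
    split_ifs <;> rw [ih _ (by omega)] <;> split_ifs <;> omega
  · intro r c τ hm ih hc
    rw [mem_staircase] at hm
    omega
  · intro r τ hr ih _ k hk
    rw [ih _ le_rfl le_rfl k hk]
    split_ifs <;> omega

theorem isAscending_staircase (n : ℕ) : IsAscending (staircase n) n := by
  intro r c hm
  rw [mem_staircase] at hm
  rw [state_staircase n r c (by omega) _ (by omega), state_staircase n r c (by omega) _ (by omega)]
  split_ifs <;> omega

theorem stateAbove_staircase (n k : ℕ) (hk : k < n) :
    stateAbove (staircase n) n 0 k = n - 1 - k := by
  rw [stateAbove_of_lt (by omega), state_staircase n _ _ le_rfl k hk]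
  split_ifs <;> omega

/-- In the reversal every pair of labels a < b < n is inverted, so it crosses in some cell of D.
Sending a cell to (a, b - a - 1) maps D onto a set containing the staircase, and counting gives
equality. -/
theorem IsAscending.eq_staircase {n : ℕ} (hD : D ⊆ staircase n) (ha : IsAscending D n)
    (hn : ∀ k < n, stateAbove D n 0 k = n - 1 - k) : D = staircase n := by
  refine Finset.eq_of_subset_of_card_le hD (le_trans (Finset.card_le_card ?_)
    (Finset.card_image_le (s := D) (f := fun x => (state D n x.1 x.2 (x.1 + x.2),
      state D n x.1 x.2 (x.1 + x.2 + 1) - state D n x.1 x.2 (x.1 + x.2) - 1))))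
  rintro ⟨r, c⟩ hm
  rw [mem_staircase] at hm
  have hi : ∀ k < n, (stateAbove D n 0)⁻¹ k = n - 1 - k := fun k hk => by
    rw [Equiv.Perm.inv_eq_iff_eq, hn _ (by omega)]; omega
  have hlt : (stateAbove D n 0)⁻¹ (r + c + 1) < (stateAbove D n 0)⁻¹ r := by
    rw [hi _ (by omega), hi _ (by omega)]; omega
  rw [stateAbove_of_lt (by omega)] at hlt
  obtain ⟨⟨i, j⟩, -, hx⟩ := crossAt_of_inverted hD (by omega) _ _ hlt
  obtain ⟨h1, h2⟩ := ha.of_crossAt hD (by omega) hx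
  refine Finset.mem_image.mpr ⟨(i, j), hx.1, ?_⟩
  simp only [h1, h2, Prod.mk.injEq, true_and]
  omega

end


/-! ### Inversions and reduced words -/

variable {n : ℕ}

theorem simpleTransposition_mul_self (i : Fin (n - 1)) :
    simpleTransposition i * simpleTransposition i = 1 := Equiv.swap_mul_self _ _

theorem lo_lt_hi (i : Fin (n - 1)) : lo i < hi i := by
  simp [lo, hi]

/-- The inversions of w s_i are the images under s_i × s_i of those of w, together with the one new
pair `(lo i, hi i)`. -/
theorem length_mul_simpleTransposition (w : Equiv.Perm (Fin n)) (i : Fin (n - 1))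
    (h : w (lo i) < w (hi i)) : length (w * simpleTransposition i) = length w + 1 := by
  classical
  unfold length
  set s := simpleTransposition i with hs
  have hs2 : ∀ p, s (s p) = p := fun p => by
    rw [← Equiv.Perm.mul_apply, simpleTransposition_mul_self]; rfl
  have sl : s (lo i) = hi i := Equiv.swap_apply_left _ _
  have sh : s (hi i) = lo i := Equiv.swap_apply_right _ _
  have hlt : ∀ p q, p < q → ¬(p = lo i ∧ q = hi i) → s p < s q := by
    intro p q hpq hne
    simp only [hs, simpleTransposition, Equiv.swap_apply_def, Fin.lt_def, Fin.ext_iff, lo, hi,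
      apply_ite Fin.val] at hpq hne ⊢
    split_ifs <;> omega
  have e : (Finset.univ.filter fun p : Fin n × Fin n => p.1 < p.2 ∧ (w * s) p.2 < (w * s) p.1) =
      insert (lo i, hi i) ((Finset.univ.filter fun p : Fin n × Fin n =>
        p.1 < p.2 ∧ w p.2 < w p.1).map (s.prodCongr s).toEmbedding) := by
    ext ⟨p, q⟩
    rw [Finset.mem_filter, Finset.mem_insert, Finset.mem_map]
    simp only [Finset.mem_filter, Finset.mem_univ, true_and, Equiv.coe_toEmbedding,
      Equiv.prodCongr_apply, Prod.exists, Prod.map, Prod.mk.injEq,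
      Equiv.Perm.mul_apply]
    constructor
    · rintro ⟨h1, h2⟩
      by_cases c : p = lo i ∧ q = hi i
      · exact Or.inl c
      · exact Or.inr ⟨s p, s q, ⟨hlt p q h1 c, h2⟩, hs2 p, hs2 q⟩
    · rintro (⟨rfl, rfl⟩ | ⟨a, b, ⟨h1, h2⟩, rfl, rfl⟩)
      · exact ⟨lo_lt_hi i, by rwa [sl, sh]⟩
      · rw [hs2, hs2]
        refine ⟨hlt a b h1 ?_, h2⟩
        rintro ⟨rfl, rfl⟩
        exact lt_asymm h h2
  rw [e, Finset.card_insert_of_notMem, Finset.card_map]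
  simp only [Finset.mem_map, Finset.mem_filter, Finset.mem_univ, true_and, Equiv.coe_toEmbedding,
    Equiv.prodCongr_apply, Prod.exists, Prod.map, Prod.mk.injEq, not_exists, not_and]
  rintro a b ⟨h1, -⟩ ha hb
  have ha' : a = hi i := by rw [← hs2 a, ha, sl]
  have hb' : b = lo i := by rw [← hs2 b, hb, sh]
  rw [ha', hb'] at h1
  exact lt_asymm h1 (lo_lt_hi i)

theorem length_eq_of_descent (w : Equiv.Perm (Fin n)) (i : Fin (n - 1))
    (h : w (hi i) < w (lo i)) : length w = length (w * simpleTransposition i) + 1 := by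
  rw [← length_mul_simpleTransposition, mul_assoc, simpleTransposition_mul_self, mul_one]
  simpa [simpleTransposition] using h

theorem ascent_or_descent (w : Equiv.Perm (Fin n)) (i : Fin (n - 1)) :
    w (lo i) < w (hi i) ∨ w (hi i) < w (lo i) :=
  lt_or_gt_of_ne fun h => lo_ne_hi i (w.injective h)

/-- The first letter of a word for w⁻¹ is the last right factor of w, and removing it changes the
number of inversions by one. -/
theorem length_le_of_isWordFor (w : Equiv.Perm (Fin n)) (a : List (Fin (n - 1)))
    (h : IsWordFor w⁻¹ a) : length w ≤ a.length := by
  induction a generalizing w with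
  | nil =>
    have : w = 1 := by simpa [IsWordFor] using h.symm
    subst this
    rw [length, List.length_nil, Nat.le_zero, Finset.card_eq_zero, Finset.filter_eq_empty_iff]
    exact fun p _ hp => lt_asymm hp.1 hp.2
  | cons i b ih =>
    have hb : IsWordFor (w * simpleTransposition i)⁻¹ b := by
      unfold IsWordFor at h ⊢
      rw [List.map_cons, List.prod_cons] at h
      rw [mul_inv_rev, ← h, inv_mul_cancel_left]
    have := ih _ hb
    rcases ascent_or_descent w i with c | c
    · have := length_mul_simpleTransposition w i c
      rw [List.length_cons]; omega
    · have := length_eq_of_descent w i c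
      rw [List.length_cons]; omega

theorem isWordFor_cons_iff (w : Equiv.Perm (Fin n)) (i : Fin (n - 1)) (b : List (Fin (n - 1))) :
    IsWordFor w⁻¹ (i :: b) ↔ IsWordFor (w * simpleTransposition i)⁻¹ b := by
  unfold IsWordFor
  rw [List.map_cons, List.prod_cons, mul_inv_rev, eq_inv_mul_iff_mul_eq]

theorem exists_descent (w : Equiv.Perm (Fin n)) (h : w ≠ 1) :
    ∃ i : Fin (n - 1), w (hi i) < w (lo i) := by
  by_contra! hc
  apply h
  have hm : StrictMono w := by
    cases n with
    | zero => exact fun a => a.elim0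
    | succ m =>
      rw [Fin.strictMono_iff_lt_succ]
      intro i
      exact lt_of_le_of_ne (hc i) fun e => lo_ne_hi (n := m + 1) i (w.injective e)
  ext1 x
  exact congrFun (hm.range_inj strictMono_id |>.mp (by simp [w.surjective.range_eq])) x

theorem exists_isWordFor_length (w : Equiv.Perm (Fin n)) :
    ∃ a, IsWordFor w⁻¹ a ∧ a.length = length w := by
  induction h : length w generalizing w with
  | zero =>
    have : w = 1 := by
      by_contra c
      obtain ⟨i, hi⟩ := exists_descent w c
      have := length_eq_of_descent w i hi
      omega
    exact ⟨[], by simp [IsWordFor, this], rfl⟩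
  | succ k ih =>
    have : w ≠ 1 := by
      rintro rfl
      have := length_le_of_isWordFor (1 : Equiv.Perm (Fin n)) [] (by simp [IsWordFor])
      rw [h] at this
      exact absurd this (by simp)
    obtain ⟨i, hi⟩ := exists_descent w this
    obtain ⟨b, hb, hl⟩ := ih (w * simpleTransposition i)
      (by have := length_eq_of_descent w i hi; omega)
    exact ⟨i :: b, (isWordFor_cons_iff w i b).mpr hb, by simp [hl]⟩

/-- The least length of a word for w⁻¹ is the number of inversions of w, so the first letter must
remove an inversion. -/
theorem IsReducedWord.of_cons {w : Equiv.Perm (Fin n)} {i : Fin (n - 1)} {b : List (Fin (n - 1))}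
    (h : IsReducedWord w⁻¹ (i :: b)) :
    w (hi i) < w (lo i) ∧ IsReducedWord (w * simpleTransposition i)⁻¹ b := by
  have hb := (isWordFor_cons_iff w i b).mp h.1
  have h1 := length_le_of_isWordFor _ b hb
  obtain ⟨a, ha, hl⟩ := exists_isWordFor_length w
  have h2 := h.2 a ha
  rw [List.length_cons] at h2
  have hd : w (hi i) < w (lo i) := by
    rcases ascent_or_descent w i with c | c
    · have := length_mul_simpleTransposition w i c
      omega
    · exact c
  have h3 := length_eq_of_descent w i hd
  refine ⟨hd, hb, fun c hc => ?_⟩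
  have := length_le_of_isWordFor _ c hc
  omega


/-! ### The generating function of pipe dreams as a product of operators -/

/-- The first `m` cells of the row `r`. -/
def rowCells (r m : ℕ) : List (ℕ × ℕ) := (List.range m).map fun c => (r, c)

/-- The cells of the rows below `k` of the staircase, in reading order. -/
def cells (N : ℕ) : ℕ → List (ℕ × ℕ)
  | 0 => []
  | k + 1 => rowCells k (N - 1 - k) ++ cells N k

/-- The effect of the cells of a list on the permutation `τ`. -/
def run (D : Finset (ℕ × ℕ)) : List (ℕ × ℕ) → Equiv.Perm ℕ → Equiv.Perm ℕ
  | [], τ => τ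
  | x :: L, τ => run D L (if x ∈ D then τ * adj (x.1 + x.2) else τ)

/-- The crosses in a list of cells exchange entries in increasing order. -/
def Ascends (D : Finset (ℕ × ℕ)) : List (ℕ × ℕ) → Equiv.Perm ℕ → Prop
  | [], _ => True
  | x :: L, τ => (x ∈ D → τ (x.1 + x.2) < τ (x.1 + x.2 + 1)) ∧
      Ascends D L (if x ∈ D then τ * adj (x.1 + x.2) else τ)

section

variable {D : Finset (ℕ × ℕ)}

theorem run_append (L L' : List (ℕ × ℕ)) (τ : Equiv.Perm ℕ) :
    run D (L ++ L') τ = run D L' (run D L τ) := by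
  induction L generalizing τ with
  | nil => rfl
  | cons x L ih => exact ih _

theorem ascends_append (L L' : List (ℕ × ℕ)) (τ : Equiv.Perm ℕ) :
    Ascends D (L ++ L') τ ↔ Ascends D L τ ∧ Ascends D L' (run D L τ) := by
  induction L generalizing τ with
  | nil => simp [Ascends, run]
  | cons x L ih => simp only [List.cons_append, Ascends, run, ih, and_assoc]

theorem run_rowCells (τ : Equiv.Perm ℕ) (r m : ℕ) : run D (rowCells r m) τ = rowState D τ r m := by
  induction m with
  | zero => rfl
  | succ m ih =>
    rw [rowCells] at ih
    rw [rowCells, List.range_succ, List.map_append, run_append, ih]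
    rfl

theorem ascends_rowCells (τ : Equiv.Perm ℕ) (r m : ℕ) : Ascends D (rowCells r m) τ ↔
    ∀ c < m, (r, c) ∈ D → rowState D τ r c (r + c) < rowState D τ r c (r + c + 1) := by
  induction m with
  | zero => simp [rowCells, Ascends]
  | succ m ih =>
    have h : rowCells r (m + 1) = rowCells r m ++ [(r, m)] := by
      simp [rowCells, List.range_succ]
    rw [h, ascends_append, ih, run_rowCells]
    simp only [Ascends, and_true, Nat.lt_succ_iff_lt_or_eq, or_imp, forall_and, forall_eq]

theorem run_cells {M k : ℕ} (hk : k ≤ M) :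
    run D (cells M k) (stateAbove D M k) = stateAbove D M 0 := by
  induction k with
  | zero => rfl
  | succ k ih =>
    rw [cells, run_append, run_rowCells, ← ih (by omega), stateAbove_of_lt (r := k) (by omega)]
    rfl

theorem ascends_cells {M k : ℕ} (hk : k ≤ M) :
    Ascends D (cells M k) (stateAbove D M k) ↔ ∀ r < k, ∀ c < M - 1 - r, (r, c) ∈ D →
      state D M r c (r + c) < state D M r c (r + c + 1) := by
  induction k with
  | zero => simp [cells, Ascends]
  | succ k ih =>
    have h : rowState D (stateAbove D M (k + 1)) k (M - 1 - k) = stateAbove D M k := by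
      rw [stateAbove_of_lt (r := k) (by omega)]; rfl
    rw [cells, ascends_append, ascends_rowCells, run_rowCells, h, ih (by omega)]
    simp only [Nat.lt_succ_iff_lt_or_eq, or_imp, forall_and, forall_eq]
    exact and_comm

theorem mem_cells {N k r c : ℕ} : (r, c) ∈ cells N k ↔ r < k ∧ r + c + 1 < N := by
  induction k with
  | zero => simp [cells]
  | succ k ih =>
    simp only [cells, rowCells, List.mem_append, List.mem_map, List.mem_range, Prod.mk.injEq, ih]
    constructor
    · rintro (⟨_, h, rfl, rfl⟩ | h) <;> omega
    · rintro h
      by_cases hr : r = k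
      · exact Or.inl ⟨c, by omega, hr.symm, rfl⟩
      · exact Or.inr ⟨by omega, h.2⟩

theorem nodup_cells (N k : ℕ) : (cells N k).Nodup := by
  induction k with
  | zero => simp [cells]
  | succ k ih =>
    rw [cells, List.nodup_append]
    refine ⟨List.nodup_range.map fun a b h => (Prod.mk.inj h).2, ih, ?_⟩
    rintro ⟨r, c⟩ h1 ⟨r', c'⟩ h2 h
    obtain ⟨_, -, h3⟩ := List.mem_map.mp h1
    have := mem_cells.mp h2
    simp only [Prod.mk.injEq] at h h3
    omega

theorem toFinset_cells (n : ℕ) : (cells n n).toFinset = staircase n := by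
  ext ⟨r, c⟩
  rw [List.mem_toFinset, mem_cells, mem_staircase]
  omega

theorem run_cells_one {n : ℕ} : run D (cells n n) 1 = stateAbove D n 0 := by
  rw [← run_cells (le_refl n), stateAbove_of_le le_rfl]

theorem ascends_cells_one {n : ℕ} (hD : D ⊆ staircase n) :
    Ascends D (cells n n) 1 ↔ IsAscending D n := by
  have h := ascends_cells (D := D) (le_refl n)
  rw [stateAbove_of_le le_rfl] at h
  rw [h]
  refine ⟨fun h r c hm => ?_, fun h r _ c _ hm => h r c hm⟩
  have := mem_staircase.mp (hD hm)
  exact h r (by omega) c (by omega) hm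

theorem run_congr {D' : Finset (ℕ × ℕ)} (L : List (ℕ × ℕ)) (h : ∀ x ∈ L, x ∈ D ↔ x ∈ D')
    (τ : Equiv.Perm ℕ) : run D L τ = run D' L τ := by
  induction L generalizing τ with
  | nil => rfl
  | cons x L ih =>
    rw [List.forall_mem_cons] at h
    simp only [run, h.1, ih h.2]

theorem ascends_congr {D' : Finset (ℕ × ℕ)} (L : List (ℕ × ℕ)) (h : ∀ x ∈ L, x ∈ D ↔ x ∈ D')
    (τ : Equiv.Perm ℕ) : Ascends D L τ ↔ Ascends D' L τ := by
  induction L generalizing τ with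
  | nil => rfl
  | cons x L ih =>
    rw [List.forall_mem_cons] at h
    simp only [Ascends, h.1, ih h.2]

end

section

variable {R : Type*} [CommRing R]

theorem chainProd_eq_prod {A : Type*} [Ring A] [Algebra R A] (u : ℕ → A) (y : ℕ → R) (N k : ℕ) :
    chainProd u y N k = ((cells N k).map fun x => 1 + y x.1 • u (x.1 + x.2)).prod := by
  induction k with
  | zero => rfl
  | succ k ih =>
    rw [chainProd, ih, cells, List.map_append, List.prod_append, rowCells, List.map_map]
    rfl

-- Choosing 1 or the operator term in each factor amounts to choosing an elbow or a cross in each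
-- cell. Operators in a product act on the argument from left to right, so the choices are run in
-- reading order, and a non-ascending cross gives zero.
open Classical in
theorem prod_rightOp_apply (y : ℕ → R) (σ : Equiv.Perm ℕ) (L : List (ℕ × ℕ)) (hL : L.Nodup)
    (τ : Equiv.Perm ℕ) :
    (L.map fun x => 1 + y x.1 • rightOp R (x.1 + x.2)).prod (Pi.single σ 1) τ =
      ∑ D ∈ L.toFinset.powerset,
        if Ascends D L τ ∧ run D L τ = σ then ∏ x ∈ D, y x.1 else 0 := by
  induction L generalizing τ with
  | nil => simp [Ascends, run, Pi.single_apply]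
  | cons x L ih =>
    rw [List.nodup_cons] at hL
    have hx : x ∉ L.toFinset := by simpa using hL.1
    rw [List.map_cons, List.prod_cons, Module.End.mul_apply, LinearMap.add_apply, Pi.add_apply,
      Module.End.one_apply, LinearMap.smul_apply, Pi.smul_apply, rightOp_apply, ih hL.2, ih hL.2,
      List.toFinset_cons, Finset.sum_powerset_insert hx]
    congr 1
    · refine Finset.sum_congr rfl fun D hD => ?_
      have hxD : x ∉ D := fun h => hx (Finset.mem_powerset.mp hD h)
      simp only [Ascends, run, hxD, if_false, false_imp_iff, true_and]
    · rw [smul_eq_mul]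
      split_ifs with hlt
      · rw [Finset.mul_sum]
        refine Finset.sum_congr rfl fun D hD => ?_
        have hxD : x ∉ D := fun h => hx (Finset.mem_powerset.mp hD h)
        have hc : ∀ z ∈ L, z ∈ insert x D ↔ z ∈ D := fun z hz => by
          rw [Finset.mem_insert, or_iff_right]
          rintro rfl
          exact hL.1 hz
        simp only [Ascends, run, Finset.mem_insert_self, if_true, hlt, imp_true_iff, true_and,
          run_congr L hc, ascends_congr L hc, Finset.prod_insert hxD, mul_ite, mul_zero]
      · rw [mul_zero]
        refine (Finset.sum_eq_zero fun D _ => if_neg ?_).symm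
        rintro ⟨⟨h, -⟩, -⟩
        exact hlt (h (Finset.mem_insert_self x D))

open Classical in
theorem coeffFrom_one (y : ℕ → R) (n : ℕ) (σ : Equiv.Perm ℕ) :
    coeffFrom y n σ 1 = ∑ D ∈ (staircase n).powerset,
      if IsAscending D n ∧ stateAbove D n 0 = σ then ∏ x ∈ D, y x.1 else 0 := by
  rw [coeffFrom, chainProd_eq_prod, prod_rightOp_apply y σ _ (nodup_cells n n), toFinset_cells]
  refine Finset.sum_congr rfl fun D hD => ?_
  rw [ascends_cells_one (Finset.mem_powerset.mp hD), run_cells_one]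

/-- Used with φ the renaming by s_i, to turn the exchange of two row variables into the action of
s_i on the polynomial. -/
theorem map_coeffFrom_one {S : Type*} [CommRing S] (φ : R →+* S) (y : ℕ → R) (n : ℕ)
    (σ : Equiv.Perm ℕ) : φ (coeffFrom y n σ 1) = coeffFrom (φ ∘ y) n σ 1 := by
  classical
  simp only [coeffFrom_one, map_sum, apply_ite φ, map_prod, map_zero, Function.comp_apply]

end


/-! ### Young Schubert polynomials -/

section

variable {n : ℕ}

/-- A permutation of `Fin n` as a permutation of `ℕ` fixing everything from `n` on. -/
def extend (w : Equiv.Perm (Fin n)) : Equiv.Perm ℕ := w.extendDomain Fin.equivSubtype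

theorem extend_apply (w : Equiv.Perm (Fin n)) (i : Fin n) : extend w i = w i :=
  w.extendDomain_apply_image Fin.equivSubtype i

theorem extend_apply_of_le (w : Equiv.Perm (Fin n)) {k : ℕ} (h : n ≤ k) : extend w k = k :=
  w.extendDomain_apply_not_subtype Fin.equivSubtype (not_lt.mpr h)

theorem eq_extend_iff (σ : Equiv.Perm ℕ) (w : Equiv.Perm (Fin n)) :
    σ = extend w⁻¹ ↔ (∀ i : Fin n, σ (w i) = i) ∧ ∀ k, n ≤ k → σ k = k := by
  constructor
  · rintro rfl
    exact ⟨fun i => by rw [extend_apply, Equiv.Perm.coe_inv, Equiv.symm_apply_apply],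
      fun k hk => extend_apply_of_le _ hk⟩
  · rintro ⟨h1, h2⟩
    ext k
    rcases lt_or_ge k n with hk | hk
    · have h3 := h1 (w⁻¹ ⟨k, hk⟩)
      rw [Equiv.Perm.coe_inv, Equiv.apply_symm_apply] at h3
      exact h3.trans (extend_apply w⁻¹ ⟨k, hk⟩).symm
    · rw [h2 k hk, extend_apply_of_le _ hk]

theorem exists_subset_staircase (D : Finset (ℕ × ℕ)) : ∃ M, D ⊆ staircase M := by
  refine ⟨D.sup (fun x => x.1 + x.2 + 2), fun x hx => ?_⟩
  have : x.1 + x.2 + 2 ≤ _ := Finset.le_sup (f := fun x : ℕ × ℕ => x.1 + x.2 + 2) hx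
  exact mem_staircase.mpr (by omega)

theorem mem_pipeDreams_iff {D : Finset (ℕ × ℕ)} {v : Equiv.Perm (Fin n)} :
    D ∈ pipeDreams v ↔
      D ⊆ staircase n ∧ IsAscending D n ∧ stateAbove D n 0 = extend v⁻¹ := by
  constructor
  · rintro ⟨hred, h1, h2⟩
    -- The theory of states needs some bounding staircase; a crude one suffices to prove that size n
    -- already works.
    obtain ⟨M, hM⟩ := exists_subset_staircase D
    have hn : D ⊆ staircase n := ((isReduced_iff hM).mp hred).subset_staircase hM
      fun k hk => (exits_iff hM).mp (h2 k hk)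
    refine ⟨hn, (isReduced_iff hn).mp hred, (eq_extend_iff _ _).mpr
      ⟨fun i => (exits_iff hn).mp (h1 i), fun k hk => (exits_iff hn).mp (h2 k hk)⟩⟩
  · rintro ⟨hn, ha, he⟩
    rw [eq_extend_iff] at he
    exact ⟨(isReduced_iff hn).mpr ha, fun i => (exits_iff hn).mpr (he.1 i),
      fun k hk => (exits_iff hn).mpr (he.2 k hk)⟩

open Classical in
theorem pipeDreams_eq (v : Equiv.Perm (Fin n)) :
    pipeDreams v = ↑((staircase n).powerset.filter fun D =>
      IsAscending D n ∧ stateAbove D n 0 = extend v⁻¹) := by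
  ext D
  rw [mem_pipeDreams_iff, Finset.mem_coe, Finset.mem_filter, Finset.mem_powerset]

theorem finite_pipeDreams (v : Equiv.Perm (Fin n)) : (pipeDreams v).Finite := by
  classical
  rw [pipeDreams_eq]
  exact Finset.finite_toSet _

variable (n) in
/-- The variable attached to a row counted from the bottom. -/
noncomputable def rowVar (r : ℕ) : MvPolynomial (Fin n) ℤ :=
  if h : r < n then MvPolynomial.X (Fin.rev ⟨r, h⟩) else 0

theorem rowVar_rev (i : Fin n) : rowVar n (Fin.rev i) = MvPolynomial.X i := by
  rw [rowVar, dif_pos (Fin.rev i).isLt, Fin.eta, Fin.rev_rev]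

theorem prod_youngWeight {D : Finset (ℕ × ℕ)} (hD : D ⊆ staircase n) :
    ∏ i : Fin n, (MvPolynomial.X i : MvPolynomial (Fin n) ℤ) ^ youngWeight n D i =
      ∏ x ∈ D, rowVar n x.1 := by
  have hlt : ∀ x ∈ D, x.1 < n := fun x hx => by
    have := mem_staircase.mp (hD hx); omega
  have h1 : ∀ i : Fin n, (MvPolynomial.X i : MvPolynomial (Fin n) ℤ) ^ youngWeight n D i =
      ∏ x ∈ D with x.1 = (Fin.revPerm i : ℕ), rowVar n x.1 := by
    intro i
    rw [youngWeight, ← rowVar_rev i, ← Finset.prod_const]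
    refine Finset.prod_congr rfl fun x hx => ?_
    rw [(Finset.mem_filter.mp hx).2]
    rfl
  rw [Finset.prod_congr rfl fun i _ => h1 i,
    Equiv.prod_comp Fin.revPerm fun j : Fin n => ∏ x ∈ D with x.1 = (j : ℕ), rowVar n x.1,
    Fin.prod_univ_eq_prod_range (fun j => ∏ x ∈ D with x.1 = j, rowVar n x.1) n]
  exact Finset.prod_fiberwise_of_maps_to (g := Prod.fst)
    (fun x hx => Finset.mem_range.mpr (hlt x hx)) _

theorem youngSchubert_eq (w : Equiv.Perm (Fin n)) :
    youngSchubert w = coeffFrom (rowVar n) n (extend (rev w)⁻¹) 1 := by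
  classical
  rw [youngSchubert, youngPipeDreams, pipeDreams_eq, finsum_mem_coe_finset, coeffFrom_one,
    ← Finset.sum_filter]
  refine Finset.sum_congr rfl fun D hD => prod_youngWeight ?_
  exact Finset.mem_powerset.mp (Finset.mem_filter.mp hD).1

theorem rev_apply (w : Equiv.Perm (Fin n)) (i : Fin n) : rev w i = w (Fin.rev i) := rfl

theorem youngSchubert_one : youngSchubert (1 : Equiv.Perm (Fin n)) = staircaseMonomial n := by
  have h : youngPipeDreams (1 : Equiv.Perm (Fin n)) = {staircase n} := by
    have hr : ∀ σ : Equiv.Perm ℕ, σ = extend (rev (1 : Equiv.Perm (Fin n)))⁻¹ ↔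
        (∀ k < n, σ k = n - 1 - k) ∧ ∀ k, n ≤ k → σ k = k := by
      intro σ
      rw [eq_extend_iff]
      refine and_congr_left fun _ => ⟨fun h k hk => ?_, fun h i => ?_⟩
      · have := h (Fin.rev ⟨k, hk⟩)
        rw [rev_apply, Fin.rev_rev] at this
        simp only [Equiv.Perm.one_apply, Fin.val_rev] at this
        omega
      · rw [rev_apply, Equiv.Perm.one_apply, h _ (Fin.rev i).isLt, Fin.val_rev]
        omega
    ext D
    rw [youngPipeDreams, mem_pipeDreams_iff, hr, Set.mem_singleton_iff]
    constructor
    · rintro ⟨hD, ha, he⟩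
      exact ha.eq_staircase hD he.1
    · rintro rfl
      exact ⟨subset_rfl, isAscending_staircase n, stateAbove_staircase n,
        stateAbove_apply_of_le subset_rfl⟩
  rw [youngSchubert, h, finsum_mem_singleton, staircaseMonomial]
  refine Finset.prod_congr rfl fun i _ => congrArg _ ?_
  have : (staircase n).filter (fun x => x.1 = (Fin.rev i : ℕ)) =
      (Finset.range i).map ⟨fun c => ((Fin.rev i : ℕ), c), fun a b h => (Prod.mk.inj h).2⟩ := by
    ext ⟨r, c⟩
    simp only [Finset.mem_filter, mem_staircase, Finset.mem_map, Finset.mem_range,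
      Function.Embedding.coeFn_mk, Prod.mk.injEq, Fin.val_rev]
    constructor
    · rintro ⟨h1, h2⟩
      exact ⟨c, by omega, by omega, rfl⟩
    · rintro ⟨_, h1, h2, rfl⟩
      omega
  rw [youngWeight, this, Finset.card_map, Finset.card_range]

theorem youngSchubert_mul_simpleTransposition (w : Equiv.Perm (Fin n)) (i : Fin (n - 1))
    (h : w (lo i) < w (hi i)) :
    youngSchubert (w * simpleTransposition i) =
      -simpleDividedDifference i (youngSchubert w) := by
  have hin := i.isLt
  -- The rows j + 1 and j from the bottom carry the variables `lo i` and `hi i`; this reversal is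
  -- the source of the minus sign.
  obtain ⟨j, hj⟩ : ∃ j : ℕ, (i : ℕ) + j + 2 = n := ⟨n - 2 - i, by omega⟩
  have hl : rowVar n (j + 1) = MvPolynomial.X (lo i) := by
    rw [← rowVar_rev, Fin.val_rev]; congr 1; simp only [lo]; omega
  have hh : rowVar n j = MvPolynomial.X (hi i) := by
    rw [← rowVar_rev, Fin.val_rev]; congr 1; simp only [hi]; omega
  have rl : ((Fin.rev (lo i) : Fin n) : ℕ) = j + 1 := by rw [Fin.val_rev]; simp only [lo]; omega
  have rh : ((Fin.rev (hi i) : Fin n) : ℕ) = j := by rw [Fin.val_rev]; simp only [hi]; omega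
  have hv : (MvPolynomial.rename (simpleTransposition i) : MvPolynomial (Fin n) ℤ →ₐ[ℤ] _) ∘
      rowVar n = rowVar n ∘ Equiv.swap j (j + 1) := by
    ext1 r
    rw [Function.comp_apply, Function.comp_apply]
    by_cases hr : r < n
    · obtain ⟨k, rfl⟩ : ∃ k : Fin n, r = (Fin.rev k : ℕ) := ⟨Fin.rev ⟨r, hr⟩, by simp⟩
      rw [rowVar_rev, MvPolynomial.rename_X, simpleTransposition]
      by_cases h1 : k = lo i
      · rw [h1, Equiv.swap_apply_left, rl, Equiv.swap_apply_right, hh]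
      by_cases h2 : k = hi i
      · rw [h2, Equiv.swap_apply_right, rh, Equiv.swap_apply_left, hl]
      rw [Equiv.swap_apply_of_ne_of_ne h1 h2, Equiv.swap_apply_of_ne_of_ne, rowVar_rev]
      · rw [← rh]; exact fun e => h2 (Fin.rev_injective (Fin.ext e))
      · rw [← rl]; exact fun e => h1 (Fin.rev_injective (Fin.ext e))
    -- The default value 0 of `rowVar` is fixed by the renaming.
    · rw [Equiv.swap_apply_of_ne_of_ne (by omega) (by omega), rowVar, dif_neg hr, map_zero]
  have hinv : (extend (rev w)⁻¹)⁻¹ = extend (rev w) := by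
    rw [extend, Equiv.Perm.extendDomain_inv, inv_inv]; rfl
  have hlt : (extend (rev w)⁻¹)⁻¹ (j + 1) < (extend (rev w)⁻¹)⁻¹ j := by
    rw [hinv, ← rl, ← rh, extend_apply, extend_apply, rev_apply, rev_apply, Fin.rev_rev,
      Fin.rev_rev]
    exact h
  have hmul : adj j * extend (rev w)⁻¹ = extend (rev (w * simpleTransposition i))⁻¹ := by
    rw [eq_extend_iff]
    constructor
    · intro k
      have e : rev (w * simpleTransposition i) k =
          rev w (Fin.rev (simpleTransposition i (Fin.rev k))) := by
        rw [rev_apply, rev_apply, Fin.rev_rev]; rfl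
      rw [Equiv.Perm.mul_apply, e, extend_apply, Equiv.Perm.coe_inv, Equiv.symm_apply_apply,
        simpleTransposition]
      by_cases h1 : k = Fin.rev (lo i)
      · rw [h1, Fin.rev_rev, Equiv.swap_apply_left, rh, rl]; exact Equiv.swap_apply_left _ _
      by_cases h2 : k = Fin.rev (hi i)
      · rw [h2, Fin.rev_rev, Equiv.swap_apply_right, rh, rl]; exact Equiv.swap_apply_right _ _
      rw [Equiv.swap_apply_of_ne_of_ne, Fin.rev_rev]
      · refine Equiv.swap_apply_of_ne_of_ne ?_ ?_
        · rw [← rh]; exact fun e => h2 (Fin.ext e)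
        · rw [← rl]; exact fun e => h1 (Fin.ext e)
      · rintro e; exact h1 (by rw [← e, Fin.rev_rev])
      · rintro e; exact h2 (by rw [← e, Fin.rev_rev])
    · intro k hk
      rw [Equiv.Perm.mul_apply, extend_apply_of_le _ hk]
      exact Equiv.swap_apply_of_ne_of_ne (by omega) (by omega)
  have key := coeffFrom_sub_swap (rowVar n) (N := n) (j := j) (by omega) hlt
  rw [hmul, ← youngSchubert_eq, ← youngSchubert_eq, hl, hh, ← hv] at key
  rw [eq_neg_iff_add_eq_zero, add_comm, ← eq_neg_iff_add_eq_zero,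
    simpleDividedDifference_eq_iff]
  have hmap := map_coeffFrom_one
    (MvPolynomial.rename (simpleTransposition i) : MvPolynomial (Fin n) ℤ →ₐ[ℤ] _).toRingHom
    (rowVar n) n (extend (rev w)⁻¹)
  rw [← youngSchubert_eq] at hmap
  refine (congrArg _ hmap).trans (key.trans ?_)
  ring

theorem simpleDividedDifference_mul_int (i : Fin (n - 1)) (k : ℤ) (f : MvPolynomial (Fin n) ℤ) :
    simpleDividedDifference i (k * f) = k * simpleDividedDifference i f := by
  rw [simpleDividedDifference_eq_iff, map_mul, map_intCast, ← mul_sub,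
    (simpleDividedDifference_eq_iff i f _).mp rfl]
  ring

/-- Removing the first letter i replaces w by the shorter w s_i, from which w is recovered by one
application of -∂_i. -/
theorem youngSchubert_eq_wordDividedDifference (a : List (Fin (n - 1))) (w : Equiv.Perm (Fin n))
    (ha : IsReducedWord w⁻¹ a) :
    youngSchubert w = (-1) ^ length w * wordDividedDifference a (staircaseMonomial n) := by
  induction a generalizing w with
  | nil =>
    have hw : w = 1 := by simpa [IsWordFor] using ha.1.symm
    have h0 : length w = 0 := Nat.le_zero.mp (length_le_of_isWordFor w [] ha.1)
    rw [h0, hw, youngSchubert_one, pow_zero, one_mul]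
    rfl
  | cons i b ih =>
    obtain ⟨hd, hb⟩ := ha.of_cons
    have h1 := youngSchubert_mul_simpleTransposition (w * simpleTransposition i) i
      (by simpa [simpleTransposition] using hd)
    rw [mul_assoc, simpleTransposition_mul_self, mul_one, ih _ hb] at h1
    have h2 := simpleDividedDifference_mul_int i ((-1) ^ length (w * simpleTransposition i))
      (wordDividedDifference b (staircaseMonomial n))
    push_cast at h2
    rw [h1, h2, length_eq_of_descent w i hd, pow_succ, mul_neg_one, neg_mul]
    rfl

end

end YoungSchubert

theorem mainTheorem9 (n : ℕ) (w : Equiv.Perm (Fin n)) :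
    (YoungSchubert.youngPipeDreams w).Finite ∧
    YoungSchubert.youngSchubert w =
      (-1) ^ YoungSchubert.length w *
        YoungSchubert.dividedDifference w⁻¹ (YoungSchubert.staircaseMonomial n) ∧
    ∀ a : List (Fin (n - 1)), YoungSchubert.IsReducedWord w⁻¹ a →
      YoungSchubert.youngSchubert w =
        (-1) ^ YoungSchubert.length w *
          YoungSchubert.wordDividedDifference a (YoungSchubert.staircaseMonomial n) :=
  ⟨YoungSchubert.finite_pipeDreams _,
    YoungSchubert.youngSchubert_eq_wordDividedDifference _ w
      (Classical.choose_spec (YoungSchubert.exists_isReducedWord w⁻¹)),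
    fun a ha => YoungSchubert.youngSchubert_eq_wordDividedDifference a w ha⟩
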